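/- There are absolute constants $A>0$, $c\in\mathbb N$ and, for every $\delta>0$, a constant $C_\delta$ depending only on $\delta$, such that the following holds. For every integer $k\ge 1$, every finite unweighted undirected graph $G=(V,E)$ with $n$ vertices has a subgraph $H\subseteq G$ on the same vertex set and a function $f$ such that: 1. $H$ is an $f(d)$-spanner of $G$, that is, $\mathrm{dist}_H(u,v)\le f(\mathrm{dist}_G(u,v))$ for all vertices $u,v$ in the same connected component of $G$; 2. $|E(H)|\le A\cdot n^{1+1/k}\cdot(\log n)^{c}$, i.e. $H$ has $\widetilde O(n^{1+1/k})$ edges; 3. for every $\delta>0$ and every integer distance $d\in[1,k^{1-\delta}]\cup[k^{1+\delta},n]$ with $1\le d\le n$, $$\frac{f(d)}{d}\le C_\delta\left(\frac kd+1\right).$$ The same $H$ and $f$ serve all $\delta>0$ and all distances $d$ simultaneously. -/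

import Mathlib

/-- `H` is an `f(d)`-spanner of the unweighted graph `G`: it is a subgraph of `G` on the same
vertex set, and `dist_H(u, v) ≤ f(dist_G(u, v))` for every pair `u, v` at finite distance in `G`.
(`SimpleGraph.dist` is `0` on unreachable pairs, so reachability in `H` is demanded explicitly;
pairs in different components of `G` carry no condition.) -/
def SimpleGraph.IsSpanner {V : Type*} (G H : SimpleGraph V) (f : ℕ → ℝ) : Prop :=
  H ≤ G ∧ ∀ u v : V, G.Reachable u v →
    H.Reachable u v ∧ (H.dist u v : ℝ) ≤ f (G.dist u v)

/-! Fix `t` and put X = n^(1/k). A hierarchy V = `U 0`, `U 1`, ... is built with |`U i`| ≤ nX /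
X^((t+1)^i). Level i makes `t` sampling steps at rate 1/P with P = X^((t+1)^i); hitting sets
derandomise each step. Each step adds about nX log n linked pairs, and sets are empty once (t+1)^L ≥
k + 2. The steps realise an alternating walk: for `x`, `y` at distance D, a vertex known to one
endpoint is either on the other's list, so `x` and `y` share a linked vertex, or is replaced by a no
farther vertex of the sparser set (`exists_sample_iterate`). The spanner takes a shortest path for
every linked pair that is not too far apart.

Stretch is proved by induction on the scale c^i (`edist_le_of_hierarchy`): a pair is spanned within
`S i` or both its ends are near `U (i+1)`. Only the first and last badly spanned pieces of a path
matter, since one bridge at the next level covers everything between them. At the top the second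
alternative is void.

Two parameter choices are used. Large `t`, about k^(1/m), with m levels gives distance O(k) for
pairs at distance up to k^(1-1/m). Constant `t` with logarithmically many levels gives constant
multiplicative stretch with additive error O(k^(1+1/m)). Replacing k by min(k, ⌈log n⌉) turns
polynomial factors in k into logarithms. Finally the spanners for different m are united; those
omitted have constants so large that n itself is bounded in terms of δ. -/

/-! ### Hitting sets and sampling along alternating walks. -/

/-- Greedy hitting set. -/
theorem Finset.exists_hitting_set {ι V : Type*} (A : Finset V)
    (N : ι → Finset V) (q : ℕ) (h : ℕ) :
    ∀ U : Finset ι, (∀ u ∈ U, N u ⊆ A ∧ q ≤ (N u).card) →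
      (U.card : ℝ) * (1 - q / A.card) ^ h < 1 → (q : ℝ) ≤ A.card →
      ∃ A' ⊆ A, A'.card ≤ h ∧ ∀ u ∈ U, ∃ z ∈ A', z ∈ N u := by
  classical
  induction h with
  | zero =>
    intro U _ hU _
    refine ⟨∅, by simp, by simp, ?_⟩
    have : U = ∅ := by
      rw [← Finset.card_eq_zero]
      have : (U.card : ℝ) < 1 := by simpa using hU
      exact_mod_cast Nat.lt_one_iff.mp (by exact_mod_cast this)
    simp [this]
  | succ h ih =>
    intro U hN hU hq
    rcases U.eq_empty_or_nonempty with rfl | hne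
    · exact ⟨∅, by simp, by simp, by simp⟩
    rcases A.eq_empty_or_nonempty with rfl | hA
    -- For empty `A` the quotient `q / 0` is `0`, so the hypothesis reads |U| < 1.
    · exact absurd hU (by simpa using hne.ne_empty)
    have hApos : (0 : ℝ) < A.card := by exact_mod_cast hA.card_pos
    have hdc : (U.card : ℝ) * q ≤ ∑ z ∈ A, ((U.filter fun u => z ∈ N u).card : ℝ) := by
      have h1 : ∑ z ∈ A, (U.filter fun u => z ∈ N u).card
          = ∑ u ∈ U, (A.filter fun z => z ∈ N u).card := by
        simp only [Finset.card_filter]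
        exact Finset.sum_comm
      have h2 : ∀ u ∈ U, q ≤ (A.filter fun z => z ∈ N u).card := by
        intro u hu
        have : A.filter (fun z => z ∈ N u) = N u := by
          ext z
          simp only [Finset.mem_filter]
          exact ⟨fun h => h.2, fun h => ⟨(hN u hu).1 h, h⟩⟩
        rw [this]
        exact (hN u hu).2
      have h3 := Finset.card_nsmul_le_sum U _ q h2
      rw [← h1, smul_eq_mul] at h3
      exact_mod_cast h3
    -- By averaging, some `z` hits a fraction q/|A| of the lists; the unhit ones shrink by 1 -
    -- q/|A|.
    obtain ⟨z, hzA, hz⟩ : ∃ z ∈ A, (U.card : ℝ) * q / A.card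
        ≤ ((U.filter fun u => z ∈ N u).card : ℝ) := by
      apply Finset.exists_le_of_sum_le hA
      rw [Finset.sum_const, nsmul_eq_mul]
      rwa [mul_div_cancel₀ _ hApos.ne']
    have hsplit : ((U.filter fun u => z ∈ N u).card : ℝ)
        + ((U.filter fun u => z ∉ N u).card : ℝ) = U.card := by
      exact_mod_cast Finset.card_filter_add_card_filter_not (s := U) (fun u => z ∈ N u)
    have hnn : (0 : ℝ) ≤ 1 - q / A.card := by
      rw [sub_nonneg, div_le_one hApos]
      exact hq
    obtain ⟨A', hA', hcard, hhit⟩ := ih (U.filter fun u => z ∉ N u)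
      (fun u hu => hN u (Finset.mem_filter.1 hu).1)
      (by
        refine lt_of_le_of_lt ?_ hU
        rw [pow_succ', ← mul_assoc]
        refine mul_le_mul_of_nonneg_right ?_ (pow_nonneg hnn _)
        have : (U.card : ℝ) * (1 - q / A.card) = U.card - U.card * q / A.card := by ring
        rw [this]
        linarith) hq
    refine ⟨insert z A', Finset.insert_subset hzA hA',
      (Finset.card_insert_le _ _).trans (by omega), fun u hu => ?_⟩
    by_cases hzu : z ∈ N u
    · exact ⟨z, Finset.mem_insert_self _ _, hzu⟩
    · obtain ⟨y, hy, hyN⟩ := hhit u (Finset.mem_filter.2 ⟨hu, hzu⟩)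
      exact ⟨y, Finset.mem_insert_of_mem hy, hyN⟩

/-- The `q` elements of `A` on which `g` is smallest. -/
theorem Finset.exists_smallest {V α : Type*} [LinearOrder α] (g : V → α) (A : Finset V) (q : ℕ)
    (hq : q ≤ A.card) :
    ∃ N ⊆ A, N.card = q ∧ ∀ w ∈ A, w ∉ N → ∀ z ∈ N, g z ≤ g w := by
  classical
  induction q with
  | zero => exact ⟨∅, by simp, by simp, by simp⟩
  | succ q ih =>
    obtain ⟨N, hN, hcard, hmin⟩ := ih (by omega)
    have hne : (A \ N).Nonempty := by
      rw [← Finset.card_pos, Finset.card_sdiff_of_subset hN]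
      omega
    obtain ⟨m, hm, hmm⟩ := Finset.exists_min_image (A \ N) g hne
    rw [Finset.mem_sdiff] at hm
    refine ⟨insert m N, Finset.insert_subset hm.1 hN, ?_, ?_⟩
    · rw [Finset.card_insert_of_notMem hm.2, hcard]
    · intro w hw hwn z hz
      rw [Finset.mem_insert, not_or] at hwn
      rcases Finset.mem_insert.1 hz with rfl | hz
      · exact hmm w (Finset.mem_sdiff.2 ⟨hw, hwn.2⟩)
      · exact hmin w hw hwn.2 z hz

/-- One sampling step: a sparser set `A'` and, for each `u`, a short list `N u` of elements of `A`,
such that every element of `A` missing from the list is at least as far from `u` as some element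
of `A'` on the list. -/
theorem exists_sample {V α : Type*} [Fintype V] [LinearOrder α] (d : V → V → α)
    (A : Finset V) (b P : ℝ) (hb : (A.card : ℝ) ≤ b) (hP : 1 ≤ P) :
    ∃ (A' : Finset V) (N : V → Finset V), (A'.card : ℝ) ≤ b / P ∧
      (∀ u, ((N u).card : ℝ) ≤ 2 * P * (Real.log (Fintype.card V) + 1) + 1) ∧
      ∀ u, ∀ w ∈ A, w ∈ N u ∨ ∃ z ∈ A', z ∈ N u ∧ d u z ≤ d u w := by
  classical
  have hP0 : 0 < P := by linarith
  have hlog : 0 ≤ Real.log (Fintype.card V) := Real.log_natCast_nonneg _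
  set T : ℝ := Real.log (Fintype.card V) + 1 with hT
  have hT1 : 1 ≤ T := by linarith
  -- The factor 2 pays for rounding b/P down to the hitting set size; the `+ 1` in `T` makes the
  -- final union bound e⁻¹ < 1.
  set q : ℕ := ⌈2 * P * T⌉₊ with hqdef
  have hq1 : 2 * P * T ≤ q := Nat.le_ceil _
  have hq2 : (q : ℝ) ≤ 2 * P * T + 1 := (Nat.ceil_lt_add_one (by positivity)).le
  by_cases hAq : A.card ≤ q
  · refine ⟨∅, fun _ => A, ?_, fun u => ?_, fun u w hw => Or.inl hw⟩
    · simp only [Finset.card_empty, Nat.cast_zero]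
      exact div_nonneg ((Nat.cast_nonneg _).trans hb) hP0.le
    · exact le_trans (by exact_mod_cast hAq) hq2
  push Not at hAq
  have hA0 : (0 : ℝ) < A.card := by exact_mod_cast (Nat.zero_le q).trans_lt hAq
  have hqA : (q : ℝ) ≤ A.card := by exact_mod_cast hAq.le
  choose N hNA hNc hNmin using fun u => Finset.exists_smallest (d u) A q hAq.le
  have hy : 1 ≤ b / P := by
    rw [le_div_iff₀ hP0]
    nlinarith
  have hbpos : 0 < b := hA0.trans_le hb
  have hh : b / P / 2 ≤ ⌊b / P⌋₊ := by
    have h1 := Nat.lt_floor_add_one (b / P)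
    have h2 : (1 : ℝ) ≤ ⌊b / P⌋₊ := by exact_mod_cast Nat.one_le_floor_iff _ |>.2 hy
    linarith
  obtain ⟨A', -, hA'c, hA'⟩ := Finset.exists_hitting_set A N q ⌊b / P⌋₊ Finset.univ
    (fun u _ => ⟨hNA u, (hNc u).ge⟩) (by
      have hn : (0 : ℝ) < Fintype.card V := by
        have : 0 < A.card := by exact_mod_cast hA0
        exact_mod_cast this.trans_le (Finset.card_le_univ A)
      have h1 : (1 - q / A.card : ℝ) ≤ Real.exp (-(q / A.card)) := by
        have := Real.add_one_le_exp (-(q / A.card : ℝ))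
        linarith
      have h0 : (0 : ℝ) ≤ 1 - q / A.card := by
        rw [sub_nonneg, div_le_one hA0]
        exact hqA
      have h2 : T ≤ ⌊b / P⌋₊ * (q / A.card : ℝ) := by
        rw [← mul_div_assoc, le_div_iff₀ hA0]
        calc T * A.card ≤ T * b := by gcongr
          _ = (b / P / 2) * (2 * P * T) := by field_simp
          _ ≤ _ := by gcongr
      calc ((Finset.univ : Finset V).card : ℝ) * (1 - q / A.card) ^ ⌊b / P⌋₊
          ≤ Fintype.card V * Real.exp (-(q / A.card)) ^ ⌊b / P⌋₊ := by
            rw [Finset.card_univ]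
            gcongr
        _ = Fintype.card V * Real.exp (-(⌊b / P⌋₊ * (q / A.card))) := by
            rw [← Real.exp_nat_mul]
            ring_nf
        _ ≤ Fintype.card V * Real.exp (-T) := by gcongr
        _ = Real.exp (-1) := by
            nth_rewrite 1 [← Real.exp_log hn]
            rw [← Real.exp_add, hT]
            ring_nf
        _ < 1 := by
            rw [Real.exp_lt_one_iff]
            norm_num) hqA
  refine ⟨A', N, ?_, fun u => by rw [hNc]; exact hq2, fun u w hw => ?_⟩
  · exact le_trans (by exact_mod_cast hA'c) (Nat.floor_le (by positivity))
  · by_cases hwN : w ∈ N u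
    · exact Or.inl hwN
    · obtain ⟨z, hz, hzN⟩ := hA' u (Finset.mem_univ u)
      exact Or.inr ⟨z, hz, hzN, hNmin u w hw hwN z hzN⟩

/-- The alternating walk: `t` sampling steps from `U` with rate `1/P`. Any two vertices of `U` at
distance `D` are both joined by pairs in `Q` to a common vertex within distance `t * D`, or one of
them is within `t * D` of the sparser set `U'`. -/
theorem exists_sample_iterate {V : Type*} [Fintype V] (G : SimpleGraph V)
    (U : Finset V) (b P : ℝ) (hb : (U.card : ℝ) ≤ b) (hP : 1 ≤ P) (t : ℕ) :
    ∃ (U' : Finset V) (Q : Finset (V × V)), (U'.card : ℝ) ≤ b / P ^ t ∧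
      (Q.card : ℝ) ≤ t * (b * (2 * P * (Real.log (Fintype.card V) + 1) + 1)) ∧
      ∀ x ∈ U, ∀ y ∈ U,
        (∃ w, (x = w ∨ (x, w) ∈ Q) ∧ (y = w ∨ (y, w) ∈ Q) ∧
          G.edist x w ≤ t * G.edist x y ∧ G.edist y w ≤ t * G.edist x y) ∨
        ∃ w ∈ U', ((x = w ∨ (x, w) ∈ Q) ∧ G.edist x w ≤ t * G.edist x y) ∨
          ((y = w ∨ (y, w) ∈ Q) ∧ G.edist y w ≤ t * G.edist x y) := by
  classical
  induction t with
  | zero =>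
    -- The walk starts at `x` itself, which is why equality is allowed beside membership in `Q`.
    refine ⟨U, ∅, by simpa using hb, by simp, fun x hx y hy => Or.inr ⟨x, hx, ?_⟩⟩
    simp
  | succ t ih =>
    obtain ⟨W, Q, hW, hQ, hwalk⟩ := ih
    obtain ⟨U', N, hU', hN, hnear⟩ := exists_sample G.edist W _ P hW hP
    refine ⟨U', Q ∪ U.biUnion fun u => (N u).image fun w => (u, w), ?_, ?_, ?_⟩
    · rwa [pow_succ, ← div_div]
    · have h1 : ((U.biUnion fun u => (N u).image fun w => (u, w)).card : ℝ)
          ≤ b * (2 * P * (Real.log (Fintype.card V) + 1) + 1) := by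
        have hlog : 0 ≤ Real.log (Fintype.card V) := Real.log_natCast_nonneg _
        calc ((U.biUnion fun u => (N u).image fun w => (u, w)).card : ℝ)
            ≤ ∑ u ∈ U, (((N u).image fun w => (u, w)).card : ℝ) := by
              exact_mod_cast Finset.card_biUnion_le
          _ ≤ ∑ u ∈ U, (2 * P * (Real.log (Fintype.card V) + 1) + 1) := by
              refine Finset.sum_le_sum fun u _ => le_trans ?_ (hN u)
              exact_mod_cast Finset.card_image_le
          _ ≤ _ := by
              rw [Finset.sum_const, nsmul_eq_mul]
              gcongr
      calc _ ≤ (Q.card : ℝ) + ((U.biUnion fun u => (N u).image fun w => (u, w)).card : ℝ) := by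
            exact_mod_cast Finset.card_union_le _ _
        _ ≤ _ := by
            push_cast
            linarith
    · have hmemQ : ∀ {x w}, (x = w ∨ (x, w) ∈ Q) →
          (x = w ∨ (x, w) ∈ Q ∪ U.biUnion fun u => (N u).image fun w => (u, w)) :=
        fun h => h.imp_right fun h => Finset.mem_union_left _ h
      have hmemN : ∀ {u w}, u ∈ U → w ∈ N u →
          (u = w ∨ (u, w) ∈ Q ∪ U.biUnion fun u => (N u).image fun w => (u, w)) :=
        fun {u w} hu hw => Or.inr <| Finset.mem_union_right _ <| Finset.mem_biUnion.2
          ⟨u, hu, Finset.mem_image.2 ⟨w, hw, rfl⟩⟩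
      have hmono : ∀ x y, (t : ℕ∞) * G.edist x y ≤ ((t + 1 : ℕ) : ℕ∞) * G.edist x y := by
        intro x y
        gcongr
        simp
      -- One move of the walk: crossing to the other endpoint adds one more copy of the distance
      -- between `x` and `y`.
      have key : ∀ x ∈ U, ∀ y ∈ U, ∀ w ∈ W, (x = w ∨ (x, w) ∈ Q) →
          G.edist x w ≤ t * G.edist x y → G.edist y w ≤ ((t + 1 : ℕ) : ℕ∞) * G.edist x y ∧
          (w ∈ N y ∨ ∃ z ∈ U', z ∈ N y ∧
            G.edist y z ≤ ((t + 1 : ℕ) : ℕ∞) * G.edist x y) := by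
        intro x hx y hy w hw hxw hd
        have hd' : G.edist y w ≤ ((t + 1 : ℕ) : ℕ∞) * G.edist x y := by
          calc G.edist y w ≤ G.edist y x + G.edist x w := G.edist_triangle
            _ ≤ G.edist x y + t * G.edist x y := by
              rw [G.edist_comm (u := y)]
              gcongr
            _ = _ := by
              push_cast
              ring
        refine ⟨hd', (hnear y w hw).imp_right ?_⟩
        rintro ⟨z, hz, hzN, hdz⟩
        exact ⟨z, hz, hzN, hdz.trans hd'⟩
      intro x hx y hy
      rcases hwalk x hx y hy with ⟨w, h1, h2, h3, h4⟩ | ⟨w, hw, ⟨h1, h2⟩ | ⟨h1, h2⟩⟩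
      · exact Or.inl ⟨w, hmemQ h1, hmemQ h2, h3.trans (hmono _ _), h4.trans (hmono _ _)⟩
      · obtain ⟨h3, h4 | ⟨z, hz, hzN, h4⟩⟩ := key x hx y hy w hw h1 h2
        · exact Or.inl ⟨w, hmemQ h1, hmemN hy h4, h2.trans (hmono _ _), h3⟩
        · exact Or.inr ⟨z, hz, Or.inr ⟨hmemN hy hzN, h4⟩⟩
      · have hc : G.edist x y = G.edist y x := G.edist_comm
        rw [hc] at h2 ⊢
        obtain ⟨h3, h4 | ⟨z, hz, hzN, h4⟩⟩ := key y hy x hx w hw h1 h2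
        · exact Or.inl ⟨w, hmemN hx h4, hmemQ h1, h3, h2.trans (hmono _ _)⟩
        · exact Or.inr ⟨z, hz, Or.inl ⟨hmemN hx hzN, h4⟩⟩

/-! ### Shortest paths and chains. -/

/-- A union of shortest paths of length at most `R` for the pairs in `Q`. -/
theorem SimpleGraph.exists_le_edist_eq {V : Type*} [Finite V] (G : SimpleGraph V)
    (Q : Finset (V × V)) (R : ℕ) :
    ∃ H ≤ G, H.edgeSet.ncard ≤ Q.card * R ∧
      ∀ x y, (x, y) ∈ Q → G.edist x y ≤ R → H.edist x y ≤ G.edist x y := by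
  classical
  induction Q using Finset.induction_on with
  | empty => exact ⟨⊥, bot_le, by simp, by simp⟩
  | insert p Q hp ih =>
    obtain ⟨H, hHG, hcard, hH⟩ := ih
    by_cases hR : G.edist p.1 p.2 ≤ R
    swap
    · refine ⟨H, hHG, hcard.trans (Nat.mul_le_mul_right _ (Finset.card_le_card
        (Finset.subset_insert _ _))), fun x y hxy hd => ?_⟩
      rcases Finset.mem_insert.1 hxy with rfl | h
      · exact absurd hd hR
      · exact hH x y h hd
    obtain ⟨w, hw⟩ := G.exists_walk_of_edist_ne_top
      (ne_top_of_le_ne_top (ENat.natCast_ne_top R) hR)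
    have hKE : (SimpleGraph.fromEdgeSet {e | e ∈ w.edges}).edgeSet = {e | e ∈ w.edges} := by
      rw [SimpleGraph.edgeSet_fromEdgeSet]
      ext e
      simp only [Set.mem_sdiff, Set.mem_ofPred_eq, and_iff_left_iff_imp]
      exact fun he hd => G.not_isDiag_of_mem_edgeSet (w.edges_subset_edgeSet he) hd
    refine ⟨H ⊔ SimpleGraph.fromEdgeSet {e | e ∈ w.edges}, sup_le hHG ?_, ?_, ?_⟩
    · rw [← SimpleGraph.edgeSet_subset_edgeSet, hKE]
      exact fun e he => w.edges_subset_edgeSet he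
    · rw [SimpleGraph.edgeSet_sup, hKE, Finset.card_insert_of_notMem hp, add_one_mul]
      refine (Set.ncard_union_le _ _).trans (add_le_add hcard ?_)
      have h1 : ({e | e ∈ w.edges} : Set (Sym2 V)) = (w.edges.toFinset : Set (Sym2 V)) := by
        ext
        simp
      rw [h1, Set.ncard_coe_finset]
      refine (List.toFinset_card_le _).trans ?_
      rw [w.length_edges]
      rw [← hw] at hR
      exact_mod_cast hR
    · intro x y hxy hd
      rcases Finset.mem_insert.1 hxy with rfl | h
      · have hmem : ∀ e ∈ w.edges,
            e ∈ (H ⊔ SimpleGraph.fromEdgeSet {e | e ∈ w.edges}).edgeSet := by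
          intro e he
          rw [SimpleGraph.edgeSet_sup, hKE]
          exact Or.inr he
        refine (SimpleGraph.edist_le (w.transfer _ hmem)).trans ?_
        rw [SimpleGraph.Walk.length_transfer, hw]
      · exact (SimpleGraph.edist_anti le_sup_left).trans (hH x y h hd)

theorem SimpleGraph.edist_le_of_chain {V : Type*} (G : SimpleGraph V) (v : ℕ → V) (s a b : ℕ)
    (hab : a ≤ b) (h : ∀ i, a ≤ i → i < b → G.edist (v i) (v (i + 1)) ≤ s) :
    G.edist (v a) (v b) ≤ ((b - a) * s : ℕ) := by
  induction b, hab using Nat.le_induction with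
  | base => simp
  | succ b hab ih =>
    calc G.edist (v a) (v (b + 1)) ≤ G.edist (v a) (v b) + G.edist (v b) (v (b + 1)) :=
          G.edist_triangle
      _ ≤ ((b - a) * s : ℕ) + (s : ℕ) :=
          add_le_add (ih fun i h1 h2 => h i h1 (by omega)) (h b hab (by omega))
      _ = ((b + 1 - a) * s : ℕ) := by
          rw [← Nat.cast_add, Nat.sub_add_comm hab, add_one_mul]

/-- Points at spacing `s` along a shortest path. -/
theorem SimpleGraph.exists_chain {V : Type*} (G : SimpleGraph V) (x y : V) (m s : ℕ)
    (h : G.edist x y ≤ (m * s : ℕ)) :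
    ∃ v : ℕ → V, v 0 = x ∧ v m = y ∧ ∀ i, G.edist (v i) (v (i + 1)) ≤ s := by
  obtain ⟨w, hw⟩ := G.exists_walk_of_edist_ne_top
    (ne_top_of_le_ne_top (ENat.natCast_ne_top _) h)
  have hlen : w.length ≤ m * s := by
    rw [← hw] at h
    exact_mod_cast h
  -- `getVert` stays at the endpoint beyond the length of the walk, so the last points may coincide.
  refine ⟨fun i => w.getVert (i * s), by simp, w.getVert_of_length_le hlen, fun i => ?_⟩
  have h1 := G.edist_le_of_chain w.getVert 1 (i * s) ((i + 1) * s)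
    (Nat.mul_le_mul_right _ (Nat.le_succ i)) (fun j _ _ => by
      by_cases hj : j < w.length
      · exact (SimpleGraph.edist_eq_one_iff_adj.2 (w.adj_getVert_succ hj)).le
      · rw [w.getVert_of_length_le (by omega), w.getVert_of_length_le (by omega)]
        simp)
  refine h1.trans ?_
  rw [add_one_mul, Nat.add_sub_cancel_left, mul_one]

/-! ### The hierarchy and its stretch recursion. -/

/-- A hierarchy of `L` levels of vertex sets; level `i` is sampled at rate `n^(-(t+1)^i/k)` in
each of `t` steps, so that the last level is empty. -/
theorem exists_hierarchy {V : Type*} [Fintype V] (G : SimpleGraph V)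
    (hn : 2 ≤ Fintype.card V) (k t L : ℕ) (hk : 1 ≤ k) (hL : k + 2 ≤ (t + 1) ^ L) :
    ∃ (U : ℕ → Finset V) (Q : Finset (V × V)), U 0 = Finset.univ ∧ U L = ∅ ∧
      (Q.card : ℝ) ≤ L * (Fintype.card V + t * (3 * (Fintype.card V : ℝ) ^ (1 + 1 / (k : ℝ)) *
        (Real.log (Fintype.card V) + 1))) ∧
      (∀ i < L, ∀ v, ∀ u ∈ U i, ∃ u' ∈ U i, (v, u') ∈ Q ∧ G.edist v u' ≤ G.edist v u) ∧
      ∀ i < L, ∀ x ∈ U i, ∀ y ∈ U i,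
        (∃ w, (x = w ∨ (x, w) ∈ Q) ∧ (y = w ∨ (y, w) ∈ Q) ∧
          G.edist x w ≤ t * G.edist x y ∧ G.edist y w ≤ t * G.edist x y) ∨
        ∃ w ∈ U (i + 1), G.edist x w ≤ t * G.edist x y ∨ G.edist y w ≤ t * G.edist x y := by
  classical
  set n : ℝ := (Fintype.card V : ℝ) with hndef
  have hn2 : (2 : ℝ) ≤ n := by
    rw [hndef]
    exact_mod_cast hn
  have hn0 : 0 < n := by linarith
  have hk0 : (0 : ℝ) < k := by exact_mod_cast hk
  set X : ℝ := n ^ (1 / (k : ℝ)) with hX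
  have hX1 : 1 < X := Real.one_lt_rpow (by linarith) (by positivity)
  have hX0 : 0 < X := by linarith
  have hXk : X ^ k = n := by
    rw [hX, ← Real.rpow_natCast, ← Real.rpow_mul hn0.le, one_div_mul_cancel hk0.ne',
      Real.rpow_one]
  have hnX : n ^ (1 + 1 / (k : ℝ)) = n * X := by rw [Real.rpow_add hn0, Real.rpow_one]
  set T : ℝ := Real.log (Fintype.card V) + 1 with hT
  have hT1 : 1 ≤ T := by
    have : 0 ≤ Real.log (Fintype.card V) := Real.log_natCast_nonneg _
    linarith
  have hstep : ∀ (i : ℕ) (U : Finset V), ∃ (U' : Finset V) (Q : Finset (V × V)),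
      ((U.card : ℝ) ≤ n * X / X ^ (t + 1) ^ i → (U'.card : ℝ) ≤ n * X / X ^ (t + 1) ^ (i + 1) ∧
        (Q.card : ℝ) ≤ t * (3 * (n * X) * T)) ∧
      ∀ x ∈ U, ∀ y ∈ U,
        (∃ w, (x = w ∨ (x, w) ∈ Q) ∧ (y = w ∨ (y, w) ∈ Q) ∧
          G.edist x w ≤ t * G.edist x y ∧ G.edist y w ≤ t * G.edist x y) ∨
        ∃ w ∈ U', G.edist x w ≤ t * G.edist x y ∨ G.edist y w ≤ t * G.edist x y := by
    intro i U
    set P : ℝ := X ^ (t + 1) ^ i with hP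
    have hP1 : 1 ≤ P := one_le_pow₀ hX1.le
    have hP0 : 0 < P := by linarith
    -- The maximum makes the step available for every `U`, so that `choose` applies; it equals `n *
    -- X / P` on the sets that occur.
    obtain ⟨U', Q, h1, h2, h3⟩ := exists_sample_iterate G U (max U.card (n * X / P)) P
      (le_max_left _ _) hP1 t
    refine ⟨U', Q, fun hU => ?_, fun x hx y hy => ?_⟩
    · rw [max_eq_right hU] at h1 h2
      constructor
      · refine h1.trans (le_of_eq ?_)
        rw [div_div, ← pow_succ', hP, ← pow_mul, pow_succ]
      · refine h2.trans (mul_le_mul_of_nonneg_left ?_ (Nat.cast_nonneg _))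
        rw [← hT]
        calc n * X / P * (2 * P * T + 1) = 2 * (n * X) * T + n * X / P := by field_simp
          _ ≤ 2 * (n * X) * T + n * X * T := by
            gcongr
            calc n * X / P ≤ n * X := div_le_self (by positivity) hP1
              _ ≤ n * X * T := le_mul_of_one_le_right (by positivity) hT1
          _ = _ := by ring
    · refine (h3 x hx y hy).imp_right ?_
      rintro ⟨w, hw, h⟩
      exact ⟨w, hw, h.imp (fun h => h.2) (fun h => h.2)⟩
  choose next pairs hcard hwalk using hstep
  let U : ℕ → Finset V := fun i =>
    Nat.rec (motive := fun _ => Finset V) Finset.univ (fun i U => next i U) i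
  have hU0 : U 0 = Finset.univ := rfl
  have hUc : ∀ i, ((U i).card : ℝ) ≤ n * X / X ^ (t + 1) ^ i := by
    intro i
    induction i with
    | zero =>
      rw [hU0, Finset.card_univ, pow_zero, pow_one, mul_div_cancel_right₀ _ hX0.ne']
    | succ i ih => exact (hcard i _ ih).1
  have hpiv : ∀ (i : ℕ) (v : V), ∃ u' : V, (U i).Nonempty → u' ∈ U i ∧ ∀ u ∈ U i, G.edist v u' ≤ G.edist v u := by
    intro i v
    rcases em (U i).Nonempty with hne | hne
    · obtain ⟨m, hm, hmin⟩ := Finset.exists_min_image (U i) (G.edist v) hne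
      exact ⟨m, fun _ => ⟨hm, hmin⟩⟩
    · exact ⟨v, fun h' => absurd h' hne⟩
  choose piv hpiv using hpiv
  refine ⟨U, (Finset.range L).biUnion fun i =>
    (Finset.univ.image fun v => (v, piv i v)) ∪ pairs i (U i), hU0, ?_, ?_, ?_, ?_⟩
  · rw [← Finset.card_eq_zero]
    have h1 : ((U L).card : ℝ) < 1 := by
      refine (hUc L).trans_lt ?_
      rw [div_lt_one (by positivity)]
      calc n * X = X ^ (k + 1) := by rw [pow_succ, hXk]
        _ < X ^ (t + 1) ^ L := pow_lt_pow_right₀ hX1 (by omega)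
    exact Nat.lt_one_iff.1 (by exact_mod_cast h1)
  · calc _ ≤ ∑ i ∈ Finset.range L,
          ((((Finset.univ.image fun v => (v, piv i v)) ∪ pairs i (U i)).card : ℕ) : ℝ) := by
          exact_mod_cast Finset.card_biUnion_le
      _ ≤ ∑ i ∈ Finset.range L, (n + t * (3 * (n * X) * T)) := by
          refine Finset.sum_le_sum fun i _ => ?_
          calc _ ≤ (((Finset.univ.image fun v => (v, piv i v)).card : ℕ) : ℝ)
                + ((pairs i (U i)).card : ℝ) := by exact_mod_cast Finset.card_union_le _ _
            _ ≤ _ := by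
              refine add_le_add ?_ (hcard i _ (hUc i)).2
              rw [hndef, ← Finset.card_univ]
              exact_mod_cast Finset.card_image_le
      _ = _ := by rw [Finset.sum_const, Finset.card_range, nsmul_eq_mul, hnX]
  · intro i hi v u hu
    obtain ⟨h1, h2⟩ := hpiv i v ⟨u, hu⟩
    refine ⟨piv i v, h1, Finset.mem_biUnion.2 ⟨i, Finset.mem_range.2 hi,
      Finset.mem_union_left _ (Finset.mem_image.2 ⟨v, Finset.mem_univ _, rfl⟩)⟩, h2 u hu⟩
  · intro i hi x hx y hy
    have hmem : ∀ {p}, p ∈ pairs i (U i) → p ∈ (Finset.range L).biUnion fun i =>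
        (Finset.univ.image fun v => (v, piv i v)) ∪ pairs i (U i) := fun hp =>
      Finset.mem_biUnion.2 ⟨i, Finset.mem_range.2 hi, Finset.mem_union_right _ hp⟩
    refine (hwalk i (U i) x hx y hy).imp_left ?_
    rintro ⟨w, h1, h2, h3⟩
    exact ⟨w, h1.imp_right hmem, h2.imp_right hmem, h3⟩

/-- Local properties of a hierarchy of vertex sets relative to a subgraph `H` pass to a stretch
bound at the top level: paths are cut into `c` pieces, and the part between the first and the last
piece that is badly stretched is bridged through the sets of the next level. -/
theorem edist_le_of_hierarchy {V : Type*} (G H : SimpleGraph V) (U : ℕ → Finset V) (t L c : ℕ)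
    (r S : ℕ → ℕ) (hU0 : ∀ v, v ∈ U 0) (hr0 : r 0 = 0)
    (hr : ∀ i ≤ L, (t + 1) * c ^ i + (2 * t + 1) * r i ≤ r (i + 1))
    (hS0 : 2 * t ≤ S 0) (hSc : ∀ i < L, c * S i ≤ S (i + 1))
    (hS : ∀ i < L, ∀ p q, p + q ≤ c → 1 ≤ q →
      p * S i + (2 * t + 1) * (q * c ^ i + 2 * r (i + 1)) ≤ S (i + 1))
    (hpiv : ∀ i ≤ L, ∀ v, ∀ u ∈ U i, G.edist v u ≤ r i →
      ∃ u' ∈ U i, G.edist v u' ≤ r i ∧ H.edist v u' ≤ r i)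
    (hwalk : ∀ i ≤ L, ∀ x ∈ U i, ∀ y ∈ U i, ∀ D : ℕ, G.edist x y ≤ D → D ≤ c ^ i + 2 * r i →
      H.edist x y ≤ (2 * t * D : ℕ) ∨
        ∃ z ∈ U (i + 1), G.edist x z ≤ (t * D : ℕ) ∨ G.edist y z ≤ (t * D : ℕ)) :
    ∀ i ≤ L, ∀ x y, G.edist x y ≤ (c ^ i : ℕ) → H.edist x y ≤ S i ∨
      (∃ u ∈ U (i + 1), G.edist x u ≤ r (i + 1)) ∧ ∃ u ∈ U (i + 1), G.edist y u ≤ r (i + 1) := by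
  intro i
  induction i with
  | zero =>
    intro _ x y hxy
    rcases hwalk 0 (Nat.zero_le _) x (hU0 x) y (hU0 y) 1 (by simpa using hxy) (by simp)
      with h | ⟨z, hz, h⟩
    · refine Or.inl (h.trans ?_)
      exact_mod_cast (mul_one (2 * t)).le.trans hS0
    · have hr1 := hr 0 (Nat.zero_le _)
      rw [hr0, pow_zero, mul_one, mul_zero, add_zero, zero_add] at hr1
      have hx1 : G.edist x y ≤ (1 : ℕ) := by simpa using hxy
      have hxz : G.edist x z ≤ (1 + t : ℕ) ∧ G.edist y z ≤ (1 + t : ℕ) := by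
        rw [mul_one] at h
        rcases h with h | h
        · refine ⟨h.trans (by exact_mod_cast Nat.le_add_left _ _), ?_⟩
          refine (G.edist_triangle (v := x)).trans ?_
          rw [G.edist_comm (u := y), Nat.cast_add]
          exact add_le_add hx1 h
        · refine ⟨?_, h.trans (by exact_mod_cast Nat.le_add_left _ _)⟩
          refine (G.edist_triangle (v := y)).trans ?_
          rw [Nat.cast_add]
          exact add_le_add hx1 h
      have hle : ((1 + t : ℕ) : ℕ∞) ≤ r (0 + 1) := by
        rw [zero_add, add_comm]
        exact_mod_cast hr1
      exact Or.inr ⟨⟨z, hz, hxz.1.trans hle⟩, z, hz, hxz.2.trans hle⟩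
  | succ i ih =>
    intro hi x y hxy
    have hi' : i < L := hi
    rw [pow_succ'] at hxy
    obtain ⟨v, hv0, hvc, hv⟩ := G.exists_chain x y c (c ^ i) hxy
    by_cases hall : ∀ a < c, H.edist (v a) (v (a + 1)) ≤ S i
    · left
      have := H.edist_le_of_chain v (S i) 0 c (Nat.zero_le _) fun a _ ha => hall a ha
      rw [hv0, hvc, Nat.sub_zero] at this
      exact this.trans (by exact_mod_cast hSc i hi')
    push Not at hall
    classical
    -- The bad pieces. By induction their ends are near `U (i + 1)`; only the outer ends of the
    -- first and the last are used.
    let B := (Finset.range c).filter fun a => (S i : ℕ∞) < H.edist (v a) (v (a + 1))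
    have hB : B.Nonempty := by
      obtain ⟨a, ha, h⟩ := hall
      exact ⟨a, Finset.mem_filter.2 ⟨Finset.mem_range.2 ha, h⟩⟩
    set a := B.min' hB with ha
    set b := B.max' hB with hb
    have haB := Finset.mem_filter.1 (B.min'_mem hB)
    have hbB := Finset.mem_filter.1 (B.max'_mem hB)
    rw [← ha, Finset.mem_range] at haB
    rw [← hb, Finset.mem_range] at hbB
    have hab : a ≤ b := Finset.min'_le_max' _ hB
    have hgood : ∀ j < c, (j < a ∨ b < j) → H.edist (v j) (v (j + 1)) ≤ S i := by
      intro j hj hjab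
      by_contra hcon
      have hjB : j ∈ B := Finset.mem_filter.2 ⟨Finset.mem_range.2 hj, not_le.1 hcon⟩
      rcases hjab with h | h
      · exact absurd (B.min'_le j hjB) (not_le.2 h)
      · exact absurd (B.le_max' j hjB) (not_le.2 h)
    obtain ⟨u, hu, hxu⟩ := ((ih hi'.le _ _ (hv a)).resolve_left (not_le.2 haB.2)).1
    obtain ⟨w, hw, hyw⟩ := ((ih hi'.le _ _ (hv b)).resolve_left (not_le.2 hbB.2)).2
    obtain ⟨u, hu, hxu, hxu'⟩ := hpiv (i + 1) hi _ u hu hxu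
    obtain ⟨w, hw, hyw, hyw'⟩ := hpiv (i + 1) hi _ w hw hyw
    set q := b + 1 - a with hq
    have hmid : G.edist (v a) (v (b + 1)) ≤ (q * c ^ i : ℕ) :=
      G.edist_le_of_chain v (c ^ i) a (b + 1) (by omega) fun j _ _ => hv j
    have hqc : q * c ^ i ≤ c ^ (i + 1) := by
      rw [pow_succ']
      exact Nat.mul_le_mul_right _ (by omega)
    have huw : G.edist u w ≤ (q * c ^ i + 2 * r (i + 1) : ℕ) := by
      calc G.edist u w ≤ G.edist u (v a) + G.edist (v a) w := G.edist_triangle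
        _ ≤ G.edist u (v a) + (G.edist (v a) (v (b + 1)) + G.edist (v (b + 1)) w) := by
          gcongr
          exact G.edist_triangle
        _ ≤ (r (i + 1) : ℕ) + ((q * c ^ i : ℕ) + (r (i + 1) : ℕ)) := by
          rw [G.edist_comm (u := u)]
          gcongr
        _ = _ := by
          push_cast
          ring
    rcases hwalk (i + 1) hi u hu w hw _ huw (by omega) with h | ⟨z, hz, h⟩
    · left
      have h1 := H.edist_le_of_chain v (S i) 0 a (Nat.zero_le _) fun j _ hj =>
        hgood j (by omega) (Or.inl hj)
      have h2 := H.edist_le_of_chain v (S i) (b + 1) c (by omega) fun j hj hjc =>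
        hgood j hjc (Or.inr (by omega))
      rw [hv0, Nat.sub_zero] at h1
      rw [hvc] at h2
      -- The `p` outer pieces cost `S i` each. With D = q c^i + 2r, the bridge costs 2tD and its two
      -- access paths 2r ≤ D, whence the factor 2t + 1.
      have hSi := hS i hi' (a + (c - (b + 1))) q (by omega) (by omega)
      calc H.edist x y ≤ H.edist x (v a) + H.edist (v a) y := H.edist_triangle
        _ ≤ H.edist x (v a) + (H.edist (v a) (v (b + 1)) + H.edist (v (b + 1)) y) := by
          gcongr
          exact H.edist_triangle
        _ ≤ H.edist x (v a) + ((H.edist (v a) u + (H.edist u w + H.edist w (v (b + 1))))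
              + H.edist (v (b + 1)) y) := by
          gcongr
          exact H.edist_triangle.trans (add_le_add le_rfl H.edist_triangle)
        _ ≤ (a * S i : ℕ) + (((r (i + 1) : ℕ) + ((2 * t * (q * c ^ i + 2 * r (i + 1)) : ℕ)
              + (r (i + 1) : ℕ))) + ((c - (b + 1)) * S i : ℕ)) := by
          rw [H.edist_comm (u := w)]
          gcongr
        _ ≤ S (i + 1) := by
          refine le_trans ?_ (Nat.cast_le.2 hSi)
          norm_cast
          nlinarith [Nat.zero_le (q * c ^ i)]
    · right
      have hri := hr (i + 1) hi
      have hb1 : t * (q * c ^ i + 2 * r (i + 1)) ≤ t * (c ^ (i + 1) + 2 * r (i + 1)) :=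
        Nat.mul_le_mul_left _ (by omega)
      have hfin : ∀ s, G.edist x s ≤ (c ^ (i + 1) : ℕ) → G.edist y s ≤ (c ^ (i + 1) : ℕ) →
          ∀ s', G.edist s s' ≤ r (i + 1) →
          G.edist s' z ≤ (t * (q * c ^ i + 2 * r (i + 1)) : ℕ) →
          (∃ u ∈ U (i + 1 + 1), G.edist x u ≤ r (i + 1 + 1)) ∧
            ∃ u ∈ U (i + 1 + 1), G.edist y u ≤ r (i + 1 + 1) := by
        intro s hxs hys s' hss hsz
        have hgen : ∀ x', G.edist x' s ≤ (c ^ (i + 1) : ℕ) → G.edist x' z ≤ r (i + 1 + 1) := by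
          intro x' hx'
          calc G.edist x' z ≤ G.edist x' s + G.edist s z := G.edist_triangle
            _ ≤ G.edist x' s + (G.edist s s' + G.edist s' z) := by
              gcongr
              exact G.edist_triangle
            _ ≤ (c ^ (i + 1) : ℕ) + ((r (i + 1) : ℕ) +
                (t * (q * c ^ i + 2 * r (i + 1)) : ℕ)) := by gcongr
            _ ≤ r (i + 1 + 1) := by
              norm_cast
              nlinarith
        exact ⟨⟨z, hz, hgen x hxs⟩, z, hz, hgen y hys⟩
      have hpre : ∀ j ≤ c, G.edist x (v j) ≤ (c ^ (i + 1) : ℕ) ∧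
          G.edist y (v j) ≤ (c ^ (i + 1) : ℕ) := by
        intro j hj
        have h1 := G.edist_le_of_chain v (c ^ i) 0 j (Nat.zero_le _) fun j _ _ => hv j
        have h2 := G.edist_le_of_chain v (c ^ i) j c hj fun j _ _ => hv j
        rw [hv0] at h1
        rw [hvc] at h2
        rw [G.edist_comm (u := y)]
        refine ⟨h1.trans (Nat.cast_le.2 ?_), h2.trans (Nat.cast_le.2 ?_)⟩ <;>
        · rw [pow_succ']
          exact Nat.mul_le_mul_right _ (by omega)
      rcases h with h | h
      · exact hfin _ (hpre a (by omega)).1 (hpre a (by omega)).2 u hxu h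
      · exact hfin _ (hpre (b + 1) (by omega)).1 (hpre (b + 1) (by omega)).2 w hyw h

/-- The growth conditions on `S` stay as hypotheses so that both regimes can use this. Radii
(3(t+1))^i absorb the displacement recursion because c ≤ 3(t+1), and they bound the length of every
path that must be added. -/
theorem exists_multilevel_spanner {V : Type*} [Fintype V] (G : SimpleGraph V)
    (hn : 2 ≤ Fintype.card V) (k t L c : ℕ) (S : ℕ → ℕ) (hk : 1 ≤ k)
    (hL : k + 2 ≤ (t + 1) ^ (L + 1)) (hc : c ≤ 3 * (t + 1))
    (hS0 : 2 * t ≤ S 0) (hSc : ∀ i < L, c * S i ≤ S (i + 1))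
    (hS : ∀ i < L, ∀ p q, p + q ≤ c → 1 ≤ q →
      p * S i + (2 * t + 1) * (q * c ^ i + 2 * (3 * (t + 1)) ^ (i + 1)) ≤ S (i + 1)) :
    ∃ H ≤ G, (H.edgeSet.ncard : ℝ) ≤ (L + 1) * (Fintype.card V + t * (3 *
        (Fintype.card V : ℝ) ^ (1 + 1 / (k : ℝ)) * (Real.log (Fintype.card V) + 1))) *
        (3 * (t + 1)) ^ (L + 1) ∧
      ∀ x y, G.edist x y ≤ (c ^ L : ℕ) → H.edist x y ≤ S L := by
  obtain ⟨U, Q, hU0, hUL, hQ, hpiv, hwalk⟩ := exists_hierarchy G hn k t (L + 1) hk hL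
  set g := 3 * (t + 1) with hg
  have hg1 : 1 ≤ g := by omega
  obtain ⟨H, hHG, hcard, hH⟩ := G.exists_le_edist_eq Q (g ^ (L + 1))
  -- Radius 0 at the bottom, where every vertex belongs to `U 0`.
  let r : ℕ → ℕ := fun i => if i = 0 then 0 else g ^ i
  have hrs : ∀ i, r (i + 1) = g ^ (i + 1) := fun i => if_neg (Nat.succ_ne_zero i)
  have hrle : ∀ i, r i ≤ g ^ i := by
    intro i
    by_cases hi : i = 0
    · simp [r, hi]
    · simp [r, hi]
  have hr : ∀ i, (t + 1) * c ^ i + (2 * t + 1) * r i ≤ r (i + 1) := by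
    intro i
    rw [hrs]
    by_cases hi : i = 0
    · subst hi
      simp only [r, if_true, pow_zero, zero_add, pow_one]
      omega
    · calc (t + 1) * c ^ i + (2 * t + 1) * r i
          ≤ (t + 1) * g ^ i + (2 * t + 1) * g ^ i :=
            add_le_add (Nat.mul_le_mul_left _ (Nat.pow_le_pow_left hc i))
              (Nat.mul_le_mul_left _ (hrle i))
        _ ≤ g * g ^ i := by
            rw [← add_mul]
            exact Nat.mul_le_mul_right _ (by omega)
        _ = g ^ (i + 1) := (pow_succ' _ _).symm
  have hlink : ∀ {x w : V} {D : ℕ}, (x = w ∨ (x, w) ∈ Q) → G.edist x w ≤ D →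
      D ≤ g ^ (L + 1) → H.edist x w ≤ D := by
    rintro x w D (rfl | h) h1 h2
    · simp
    · exact (hH x w h (h1.trans (Nat.cast_le.2 h2))).trans h1
  refine ⟨H, hHG, ?_, fun x y hxy => ?_⟩
  · calc (H.edgeSet.ncard : ℝ) ≤ (Q.card : ℝ) * (g ^ (L + 1) : ℕ) := by exact_mod_cast hcard
      _ ≤ _ := by
        push_cast at hQ ⊢
        rw [hg]
        push_cast
        exact mul_le_mul_of_nonneg_right hQ (by positivity)
  · refine ((edist_le_of_hierarchy G H U t L c r S (fun v => ?_) (if_pos rfl) (fun i _ => hr i)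
      hS0 hSc ?_ ?_ ?_) L le_rfl x y hxy).resolve_right ?_
    · rw [hU0]
      exact Finset.mem_univ v
    · intro i hi p q hpq hq
      rw [hrs]
      exact hS i hi p q hpq hq
    · intro i hi v u hu hvu
      obtain ⟨u', hu', hQ', hd⟩ := hpiv i (by omega) v u hu
      have h1 := hd.trans hvu
      refine ⟨u', hu', h1, hlink (Or.inr hQ') h1 ?_⟩
      exact (hrle i).trans (Nat.pow_le_pow_right hg1 (by omega))
    · intro i hi x hx y hy D hD hDle
      have htD : t * D ≤ g ^ (L + 1) := by
        calc t * D ≤ t * (c ^ i + 2 * r i) := Nat.mul_le_mul_left _ hDle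
          _ ≤ (t + 1) * c ^ i + (2 * t + 1) * r i := by nlinarith [Nat.zero_le (c ^ i)]
          _ ≤ r (i + 1) := hr i
          _ ≤ g ^ (i + 1) := hrle _
          _ ≤ g ^ (L + 1) := Nat.pow_le_pow_right hg1 (by omega)
      have hmul : (t : ℕ∞) * G.edist x y ≤ (t * D : ℕ) := by
        rw [Nat.cast_mul]
        gcongr
      rcases hwalk i (by omega) x hx y hy with ⟨w, h1, h2, h3, h4⟩ | ⟨w, hw, h⟩
      · left
        calc H.edist x y ≤ H.edist x w + H.edist w y := H.edist_triangle
          _ ≤ (t * D : ℕ) + (t * D : ℕ) := by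
            rw [H.edist_comm (u := w)]
            exact add_le_add (hlink h1 (h3.trans hmul) htD) (hlink h2 (h4.trans hmul) htD)
          _ = (2 * t * D : ℕ) := by
            push_cast
            ring
      · exact Or.inr ⟨w, hw, h.imp (fun h => h.trans hmul) fun h => h.trans hmul⟩
    · rintro ⟨⟨u, hu, -⟩, -⟩
      rw [hUL] at hu
      exact absurd hu (Finset.notMem_empty u)

theorem card_le_rpow_mul_log {n : ℕ} (hn : 2 ≤ n) (k : ℕ) :
    (n : ℝ) ≤ (n : ℝ) ^ (1 + 1 / (k : ℝ)) * (Real.log n + 1) := by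
  have hn1 : (1 : ℝ) ≤ n := by exact_mod_cast (by omega : 1 ≤ n)
  have hlog : 0 ≤ Real.log n := Real.log_natCast_nonneg _
  calc (n : ℝ) = (n : ℝ) ^ (1 : ℝ) * 1 := by simp
    _ ≤ _ := by
      gcongr
      · have : (0 : ℝ) ≤ 1 / (k : ℝ) := by positivity
        linarith
      · linarith

-- The two parameter regimes.

universe u

/-- Additive stretch `O(k)` for pairs at distance at most `k^(1-1/m)`. -/
theorem exists_short_range_spanner (m : ℕ) (hm : 1 ≤ m) :
    ∃ C : ℝ, 0 < C ∧ ∀ (k : ℕ), 1 ≤ k → ∀ (V : Type u) [Fintype V] (G : SimpleGraph V),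
      2 ≤ Fintype.card V → ∃ H ≤ G,
        (H.edgeSet.ncard : ℝ) ≤ C * k ^ 3 * ((Fintype.card V : ℝ) ^ (1 + 1 / (k : ℝ)) *
          (Real.log (Fintype.card V) + 1)) ∧
        ∀ x y, ∀ d : ℕ, G.edist x y ≤ d → (d : ℝ) ≤ (k : ℝ) ^ (1 - 1 / (m : ℝ)) →
          ∃ e : ℕ, H.edist x y ≤ e ∧ (e : ℝ) ≤ C * k := by
  refine ⟨m * (4 * 3 ^ (m + 1)) * 3 ^ (2 * m + 1) + 8 * 3 ^ (2 * m + 1), by positivity, ?_⟩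
  intro k hk V _ G hn
  obtain ⟨L, rfl⟩ : ∃ L, m = L + 1 := ⟨m - 1, by omega⟩
  have hk1 : (1 : ℝ) ≤ k := by exact_mod_cast hk
  have hk0 : (0 : ℝ) < k := by linarith
  have hm0 : (0 : ℝ) < ((L + 1 : ℕ) : ℝ) := by exact_mod_cast hm
  set a : ℝ := ((k : ℝ) + 2) ^ (1 / ((L + 1 : ℕ) : ℝ)) with ha
  have ha1 : 1 ≤ a := Real.one_le_rpow (by linarith) (by positivity)
  have ham : a ^ (L + 1) = k + 2 := by
    rw [ha, ← Real.rpow_natCast, ← Real.rpow_mul (by positivity), one_div_mul_cancel hm0.ne',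
      Real.rpow_one]
  set t := ⌈a⌉₊ with ht
  have hat : a ≤ t := Nat.le_ceil a
  have hta : (t : ℝ) + 1 ≤ 3 * a := by
    have := Nat.ceil_lt_add_one (by linarith : 0 ≤ a)
    rw [← ht] at this
    linarith
  have htm : ((t : ℝ) + 1) ^ (L + 1) ≤ 3 ^ (L + 1 + 1) * k := by
    calc ((t : ℝ) + 1) ^ (L + 1) ≤ (3 * a) ^ (L + 1) := by gcongr
      _ = 3 ^ (L + 1) * (k + 2) := by rw [mul_pow, ham]
      _ ≤ 3 ^ (L + 1) * (3 * k) := by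
        gcongr
        linarith
      _ = _ := by ring
  have htk : (t : ℝ) ≤ 3 ^ (L + 1 + 1) * k := by
    refine le_trans ?_ htm
    calc (t : ℝ) ≤ (t : ℝ) + 1 := by linarith
      _ ≤ _ := le_self_pow₀ (by linarith [(Nat.cast_nonneg t : (0 : ℝ) ≤ t)]) (by omega)
  have hL : k + 2 ≤ (t + 1) ^ (L + 1) := by
    have : (k : ℝ) + 2 ≤ ((t : ℝ) + 1) ^ (L + 1) := by
      rw [← ham]
      gcongr
      linarith
    exact_mod_cast this
  -- Bounding `p` and `q` separately by t + 1 loses a factor 3 per level, harmless because the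
  -- number of levels is fixed by `m`.
  obtain ⟨H, hHG, hcard, hH⟩ := exists_multilevel_spanner G hn k t L (t + 1)
    (fun i => 8 * 3 ^ i * (t + 1) ^ (i + 1)) hk hL (by omega)
    (by
      simp only [pow_zero, zero_add, pow_one, mul_one]
      omega)
    (fun i _ => by
      calc (t + 1) * (8 * 3 ^ i * (t + 1) ^ (i + 1)) = 8 * 3 ^ i * (t + 1) ^ (i + 1 + 1) := by ring
        _ ≤ 8 * 3 ^ (i + 1) * (t + 1) ^ (i + 1 + 1) :=
          Nat.mul_le_mul_right _ (Nat.mul_le_mul_left _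
            (Nat.pow_le_pow_right (by norm_num) (by omega))))
    (fun i _ p q hpq hq => by
      have hp : p ≤ t + 1 := by omega
      have hq' : q ≤ t + 1 := by omega
      have h3 : 1 ≤ 3 ^ i := Nat.one_le_pow _ _ (by norm_num)
      calc p * (8 * 3 ^ i * (t + 1) ^ (i + 1)) +
            (2 * t + 1) * (q * (t + 1) ^ i + 2 * (3 * (t + 1)) ^ (i + 1))
          ≤ (t + 1) * (8 * 3 ^ i * (t + 1) ^ (i + 1)) +
            (2 * (t + 1)) * ((t + 1) * (t + 1) ^ i + 2 * (3 * (t + 1)) ^ (i + 1)) := by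
            gcongr
            omega
        _ = (20 * 3 ^ i + 2 * 1) * (t + 1) ^ (i + 1 + 1) := by
            rw [mul_pow]
            ring
        _ ≤ (20 * 3 ^ i + 2 * 3 ^ i) * (t + 1) ^ (i + 1 + 1) := by gcongr
        _ ≤ 24 * 3 ^ i * (t + 1) ^ (i + 1 + 1) := by
            gcongr
            omega
        _ = 8 * 3 ^ (i + 1) * (t + 1) ^ (i + 1 + 1) := by ring)
  refine ⟨H, hHG, hcard.trans ?_, fun x y d hd hdk => ⟨_, hH x y (hd.trans ?_), ?_⟩⟩
  · set M : ℝ := (Fintype.card V : ℝ) ^ (1 + 1 / (k : ℝ)) * (Real.log (Fintype.card V) + 1)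
    have hnM : (Fintype.card V : ℝ) ≤ M := card_le_rpow_mul_log hn k
    have hM0 : 0 ≤ M := (Nat.cast_nonneg _).trans hnM
    have h31 : (1 : ℝ) ≤ 3 ^ (L + 1 + 1) * k := by
      have : (1 : ℝ) ≤ 3 ^ (L + 1 + 1) := one_le_pow₀ (by norm_num)
      nlinarith
    calc ((L : ℝ) + 1) * (Fintype.card V + t * (3 *
          (Fintype.card V : ℝ) ^ (1 + 1 / (k : ℝ)) * (Real.log (Fintype.card V) + 1))) *
          (3 * (t + 1)) ^ (L + 1)
        = (L + 1) * (Fintype.card V + t * (3 * M)) * (3 ^ (L + 1) * (t + 1) ^ (L + 1)) := by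
          rw [mul_pow, mul_assoc 3]
      _ ≤ (L + 1) * (3 ^ (L + 1 + 1) * k * M + 3 ^ (L + 1 + 1) * k * (3 * M)) *
          (3 ^ (L + 1) * (3 ^ (L + 1 + 1) * k)) := by
          gcongr
          exact hnM.trans (le_mul_of_one_le_left hM0 h31)
      _ = (((L + 1 : ℕ) : ℝ) * (4 * 3 ^ (L + 1 + 1)) * 3 ^ (2 * (L + 1) + 1)) * k ^ 2 * M := by
          push_cast
          ring
      _ ≤ _ := by
          gcongr
          · have : (0 : ℝ) ≤ 8 * 3 ^ (2 * (L + 1) + 1) := by positivity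
            linarith
          · norm_num
  · have h1 : (d : ℝ) ≤ ((t : ℝ) + 1) ^ L := by
      calc (d : ℝ) ≤ (k : ℝ) ^ (1 - 1 / ((L + 1 : ℕ) : ℝ)) := hdk
        _ ≤ ((k : ℝ) + 2) ^ (1 - 1 / ((L + 1 : ℕ) : ℝ)) := by
          refine Real.rpow_le_rpow hk0.le (by linarith) ?_
          rw [sub_nonneg, div_le_one hm0]
          exact_mod_cast hm
        _ = a ^ L := by
          rw [ha, ← Real.rpow_natCast, ← Real.rpow_mul (by positivity)]
          congr 1
          push_cast
          field_simp
          ring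
        _ ≤ _ := by
          gcongr
          linarith
    exact_mod_cast h1
  · push_cast
    calc 8 * 3 ^ L * ((t : ℝ) + 1) ^ (L + 1) ≤ 8 * 3 ^ L * (3 ^ (L + 1 + 1) * k) := by gcongr
      _ = 8 * 3 ^ (L + L + 2) * k := by ring
      _ ≤ 8 * 3 ^ (2 * (L + 1) + 1) * k := by
        refine mul_le_mul_of_nonneg_right (mul_le_mul_of_nonneg_left ?_ (by norm_num)) hk0.le
        exact pow_le_pow_right₀ (by norm_num) (by omega)
      _ ≤ _ := by
        gcongr
        have : (0 : ℝ) ≤ ((L : ℝ) + 1) * (4 * 3 ^ (L + 1 + 1)) * 3 ^ (2 * (L + 1) + 1) := by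
          positivity
        linarith

/-- Constant multiplicative stretch up to an additive error `O(k^(1+1/m))`. -/
theorem exists_long_range_spanner (m : ℕ) (hm : 1 ≤ m) :
    ∃ C : ℝ, 0 < C ∧ ∀ (k : ℕ), 1 ≤ k → ∀ (V : Type u) [Fintype V] (G : SimpleGraph V),
      2 ≤ Fintype.card V → ∃ H ≤ G,
        (H.edgeSet.ncard : ℝ) ≤ C * k ^ 3 * ((Fintype.card V : ℝ) ^ (1 + 1 / (k : ℝ)) *
          (Real.log (Fintype.card V) + 1)) ∧
        ∀ x y, ∀ d : ℕ, G.edist x y ≤ d →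
          ∃ e : ℕ, H.edist x y ≤ e ∧ (e : ℝ) ≤ C * (d + (k : ℝ) ^ (1 + 1 / (m : ℝ))) := by
  -- With t + 1 = 3^m, the factor 3 per level in (3(t+1))^(L+1) is an m-th root of t + 1, so over
  -- all levels it totals O(k^(1/m)).
  obtain ⟨t, ht⟩ : ∃ t, t + 1 = 3 ^ m := ⟨3 ^ m - 1, Nat.sub_add_cancel (Nat.one_le_pow _ _
    (by norm_num))⟩
  refine ⟨4 * 3 ^ (4 * m + 3) + 18 * (t + 1) ^ 2 * 3 ^ (2 * m + 2), by positivity, ?_⟩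
  intro k hk V _ G hn
  have hk1 : (1 : ℝ) ≤ k := by exact_mod_cast hk
  have hk0 : (0 : ℝ) < k := by linarith
  have hm0 : (0 : ℝ) < m := by exact_mod_cast hm
  have ht1 : 1 < t + 1 := by
    rw [ht]
    exact Nat.one_lt_pow (by omega) (by norm_num)
  have htR : (t : ℝ) + 1 = 3 ^ m := by exact_mod_cast ht
  obtain ⟨L, hLeq⟩ : ∃ L, Nat.clog (t + 1) (k + 2) = L + 1 :=
    ⟨_, (Nat.succ_pred_eq_of_pos (Nat.clog_pos ht1 (by omega))).symm⟩
  have hL : k + 2 ≤ (t + 1) ^ (L + 1) := by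
    rw [← hLeq]
    exact Nat.le_pow_clog ht1 _
  have hL' : (t + 1) ^ L < k + 2 := by
    have := Nat.pow_pred_clog_lt_self ht1 (x := k + 2) (by omega)
    rwa [hLeq] at this
  have hpow : ((t : ℝ) + 1) ^ (L + 1) ≤ 3 ^ (m + 1) * k := by
    have : ((t : ℝ) + 1) ^ L ≤ k + 2 := by exact_mod_cast hL'.le
    calc ((t : ℝ) + 1) ^ (L + 1) = ((t : ℝ) + 1) ^ L * ((t : ℝ) + 1) := pow_succ _ _
      _ ≤ (3 * k) * 3 ^ m := by
        rw [htR] at this ⊢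
        gcongr
        linarith
      _ = _ := by ring
  have h3L : (3 : ℝ) ^ (L + 1) ≤ 3 ^ (m + 1) * (k : ℝ) ^ (1 / (m : ℝ)) := by
    refine le_of_pow_le_pow_left₀ (n := m) (by omega) (by positivity) ?_
    calc ((3 : ℝ) ^ (L + 1)) ^ m = ((t : ℝ) + 1) ^ (L + 1) := by
          rw [htR, ← pow_mul, ← pow_mul, mul_comm]
      _ ≤ 3 ^ (m + 1) * k := hpow
      _ ≤ (3 ^ (m + 1)) ^ m * k := by
        gcongr
        exact le_self_pow₀ (one_le_pow₀ (by norm_num)) (by omega)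
      _ = _ := by
        rw [mul_pow, ← Real.rpow_natCast ((k : ℝ) ^ _), ← Real.rpow_mul hk0.le,
          one_div_mul_cancel hm0.ne', Real.rpow_one]
  have hkm : (k : ℝ) ^ (1 / (m : ℝ)) ≤ k := by
    calc (k : ℝ) ^ (1 / (m : ℝ)) ≤ (k : ℝ) ^ (1 : ℝ) := by
          refine Real.rpow_le_rpow_of_exponent_le hk1 ?_
          rw [div_le_one hm0]
          exact_mod_cast hm
      _ = k := Real.rpow_one _
  have hg : (3 * ((t : ℝ) + 1)) ^ (L + 1) ≤ 3 ^ (2 * m + 2) * (k : ℝ) ^ (1 + 1 / (m : ℝ)) := by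
    calc (3 * ((t : ℝ) + 1)) ^ (L + 1) = 3 ^ (L + 1) * ((t : ℝ) + 1) ^ (L + 1) := mul_pow _ _ _
      _ ≤ (3 ^ (m + 1) * (k : ℝ) ^ (1 / (m : ℝ))) * (3 ^ (m + 1) * k) := by gcongr
      _ = _ := by
        rw [Real.rpow_add hk0, Real.rpow_one]
        ring
  set g := 3 * (t + 1) with hgdef
  have hg0 : 0 < g := by omega
  set α := 18 * (t + 1) ^ 2 with hα
  -- A bridge over `q` pieces costs no more than `q` pieces at stretch α, so the stretch does not
  -- grow with the level.
  have hαg : ∀ q, 1 ≤ q → (2 * t + 1) * (q + 2 * g) ≤ q * α := by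
    intro q hq
    calc (2 * t + 1) * (q + 2 * g) ≤ (2 * t + 1) * (q + 2 * (q * g)) := by
          gcongr
          exact Nat.le_mul_of_pos_left _ hq
      _ = q * ((2 * t + 1) * (6 * t + 7)) := by
        rw [hgdef]
        ring
      _ ≤ q * α := by
        gcongr
        rw [hα]
        nlinarith
  obtain ⟨H, hHG, hcard, hH⟩ := exists_multilevel_spanner G hn k t L g
    (fun i => α * g ^ i) hk hL le_rfl (by
      rw [pow_zero, mul_one, hα]
      nlinarith)
    (fun i _ => by
      rw [pow_succ']
      exact (by ring : g * (α * g ^ i) = α * (g * g ^ i)).le)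
    (fun i _ p q hpq hq => by
      have h1 := Nat.mul_le_mul_right (g ^ i) (hαg q hq)
      have h2 := Nat.mul_le_mul_right (α * g ^ i) hpq
      calc p * (α * g ^ i) + (2 * t + 1) * (q * g ^ i + 2 * g ^ (i + 1))
          = p * (α * g ^ i) + (2 * t + 1) * (q + 2 * g) * g ^ i := by ring
        _ ≤ p * (α * g ^ i) + q * α * g ^ i := by gcongr
        _ = (p + q) * (α * g ^ i) := by ring
        _ ≤ g * (α * g ^ i) := h2
        _ = α * g ^ (i + 1) := by ring)
  have hα' : (α : ℝ) = 18 * ((t : ℝ) + 1) ^ 2 := by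
    rw [hα]
    push_cast
    ring
  refine ⟨H, hHG, hcard.trans ?_, fun x y d hd => ?_⟩
  · set M : ℝ := (Fintype.card V : ℝ) ^ (1 + 1 / (k : ℝ)) * (Real.log (Fintype.card V) + 1)
    have hnM : (Fintype.card V : ℝ) ≤ M := card_le_rpow_mul_log hn k
    have hM0 : 0 ≤ M := (Nat.cast_nonneg _).trans hnM
    have hLk : (L : ℝ) + 1 ≤ 3 ^ (m + 1) * k := by
      have h1 : ((L + 1 : ℕ) : ℝ) ≤ ((3 ^ (L + 1) : ℕ) : ℝ) := by
        exact_mod_cast (Nat.lt_pow_self (by norm_num : 1 < 3)).le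
      push_cast at h1
      exact h1.trans (h3L.trans (by gcongr))
    have hg2 : (3 * ((t : ℝ) + 1)) ^ (L + 1) ≤ 3 ^ (2 * m + 2) * (k : ℝ) ^ 2 := by
      refine hg.trans ?_
      rw [Real.rpow_add hk0, Real.rpow_one, sq]
      gcongr
    have ht3 : (t : ℝ) ≤ 3 ^ m := by linarith
    have h31 : (1 : ℝ) ≤ 3 ^ m := one_le_pow₀ (by norm_num)
    calc ((L : ℝ) + 1) * (Fintype.card V + t * (3 *
          (Fintype.card V : ℝ) ^ (1 + 1 / (k : ℝ)) * (Real.log (Fintype.card V) + 1))) *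
          (3 * (t + 1)) ^ (L + 1)
        = (L + 1) * (Fintype.card V + t * (3 * M)) * (3 * (t + 1)) ^ (L + 1) := by
          rw [mul_assoc 3]
      _ ≤ (3 ^ (m + 1) * k) * (3 ^ m * M + 3 ^ m * (3 * M)) *
          (3 ^ (2 * m + 2) * (k : ℝ) ^ 2) := by
          gcongr
          exact hnM.trans (le_mul_of_one_le_left hM0 h31)
      _ = 4 * 3 ^ (4 * m + 3) * k ^ 3 * M := by ring
      _ ≤ _ := by
          gcongr
          have : (0 : ℝ) ≤ 18 * ((t : ℝ) + 1) ^ 2 * 3 ^ (2 * m + 2) := by positivity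
          linarith
  · have hgL : 0 < g ^ L := Nat.pow_pos hg0
    obtain ⟨v, hv0, hvm, hv⟩ := G.exists_chain x y (d / g ^ L + 1) (g ^ L)
      (hd.trans (Nat.cast_le.2 (Nat.lt_div_mul_add hgL).le |>.trans (by rw [add_one_mul])))
    have h1 := H.edist_le_of_chain v (α * g ^ L) 0 (d / g ^ L + 1) (Nat.zero_le _)
      fun i _ _ => hH _ _ (hv i)
    rw [hv0, hvm, Nat.sub_zero] at h1
    refine ⟨_, h1, ?_⟩
    have h2 : (d / g ^ L + 1) * (α * g ^ L) ≤ α * (d + g ^ (L + 1)) := by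
      calc (d / g ^ L + 1) * (α * g ^ L) = α * (d / g ^ L * g ^ L + g ^ L) := by ring
        _ ≤ α * (d + g ^ (L + 1)) := by
          gcongr
          · exact Nat.div_mul_le_self _ _
          · omega
    have hgc : ((g : ℕ) : ℝ) = 3 * ((t : ℝ) + 1) := by
      rw [hgdef]
      push_cast
      ring
    calc (((d / g ^ L + 1) * (α * g ^ L) : ℕ) : ℝ) ≤ ((α * (d + g ^ (L + 1)) : ℕ) : ℝ) := by
          exact_mod_cast h2
      _ = 18 * ((t : ℝ) + 1) ^ 2 * (d + (3 * ((t : ℝ) + 1)) ^ (L + 1)) := by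
          push_cast
          rw [hα', hgc]
      _ ≤ 18 * ((t : ℝ) + 1) ^ 2 * (3 ^ (2 * m + 2) * d +
            3 ^ (2 * m + 2) * (k : ℝ) ^ (1 + 1 / (m : ℝ))) := by
          gcongr
          exact le_mul_of_one_le_left (Nat.cast_nonneg _) (one_le_pow₀ (by norm_num))
      _ = 18 * ((t : ℝ) + 1) ^ 2 * 3 ^ (2 * m + 2) * (d + (k : ℝ) ^ (1 + 1 / (m : ℝ))) := by ring
      _ ≤ _ := by
          gcongr
          have : (0 : ℝ) ≤ 4 * 3 ^ (4 * m + 3) := by positivity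
          linarith

/-! ### Uniting the spanners. -/

theorem SimpleGraph.ncard_edgeSet_sup_le {V : Type*} (G H : SimpleGraph V) :
    (G ⊔ H).edgeSet.ncard ≤ G.edgeSet.ncard + H.edgeSet.ncard := by
  rw [SimpleGraph.edgeSet_sup]
  exact Set.ncard_union_le _ _

theorem SimpleGraph.ncard_edgeSet_finset_sup_le {V ι : Type*} (s : Finset ι)
    (H : ι → SimpleGraph V) :
    (s.sup H).edgeSet.ncard ≤ ∑ i ∈ s, (H i).edgeSet.ncard := by
  classical
  induction s using Finset.induction_on with
  | empty => simp
  | insert a s ha ih =>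
    rw [Finset.sup_insert, Finset.sum_insert ha]
    exact (SimpleGraph.ncard_edgeSet_sup_le _ _).trans (Nat.add_le_add_left ih _)

/-- Spanners serving a single value `1/m` of `δ`; the number of logarithmic factors does not
depend on `m`. -/
theorem exists_spanner_of_exponent (m : ℕ) (hm : 1 ≤ m) :
    ∃ C : ℝ, 0 < C ∧ ∀ (k : ℕ), 1 ≤ k → ∀ (V : Type u) [Fintype V] (G : SimpleGraph V),
      2 ≤ Fintype.card V → ∃ H ≤ G,
        (H.edgeSet.ncard : ℝ) ≤ C * ((Fintype.card V : ℝ) ^ (1 + 1 / (k : ℝ)) *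
          (Real.log (Fintype.card V) + 1) ^ 4) ∧
        ∀ x y, ∀ d : ℕ, G.edist x y ≤ d → ∃ e : ℕ, H.edist x y ≤ e ∧
          ((d : ℝ) ≤ (k : ℝ) ^ (1 - 1 / (m : ℝ)) ∨ (k : ℝ) ^ (1 + 1 / (m : ℝ)) ≤ d →
            (e : ℝ) ≤ C * (k + d)) := by
  obtain ⟨C₁, hC₁, h₁⟩ := exists_short_range_spanner.{u} (2 * m) (by omega)
  obtain ⟨C₂, hC₂, h₂⟩ := exists_long_range_spanner.{u} (2 * m) (by omega)
  refine ⟨(C₁ + C₂) * Real.exp 1, by positivity, ?_⟩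
  intro k hk V _ G hn
  set n : ℝ := (Fintype.card V : ℝ) with hndef
  have hn2 : (2 : ℝ) ≤ n := by
    rw [hndef]
    exact_mod_cast hn
  have hn0 : 0 < n := by linarith
  have hlog : 0 < Real.log n := Real.log_pos (by linarith)
  set T : ℝ := Real.log n + 1 with hT
  have hT0 : 0 < T := by linarith
  -- Beyond log n a larger parameter saves only a constant: n^(1/l) ≤ e there, and l^3 is
  -- polylogarithmic.
  set l := min k ⌈Real.log n⌉₊ with hl
  have hl1 : 1 ≤ l := le_min hk (Nat.one_le_ceil_iff.2 hlog)
  have hlk : (l : ℝ) ≤ k := by exact_mod_cast min_le_left _ _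
  have hl1' : (1 : ℝ) ≤ l := by exact_mod_cast hl1
  have hl0 : (0 : ℝ) < l := by linarith
  have hk1 : (1 : ℝ) ≤ k := by linarith
  have hlT : (l : ℝ) ≤ T := by
    have h1 : (l : ℝ) ≤ (⌈Real.log n⌉₊ : ℝ) := by exact_mod_cast min_le_right _ _
    exact h1.trans (Nat.ceil_lt_add_one hlog.le).le
  have he1 : 1 ≤ Real.exp 1 := Real.one_le_exp (by norm_num)
  have hnl : n ^ (1 + 1 / (l : ℝ)) ≤ Real.exp 1 * n ^ (1 + 1 / (k : ℝ)) := by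
    rcases min_choice k ⌈Real.log n⌉₊ with h | h
    · rw [hl, h]
      exact le_mul_of_one_le_left (by positivity) he1
    · have h1 : Real.log n ≤ l := by
        rw [hl, h]
        exact Nat.le_ceil _
      have h2 : n ^ (1 / (l : ℝ)) ≤ Real.exp 1 := by
        rw [Real.rpow_def_of_pos hn0, mul_one_div]
        exact Real.exp_le_exp.2 ((div_le_one hl0).2 h1)
      rw [Real.rpow_add hn0, Real.rpow_one, mul_comm]
      refine mul_le_mul h2 ?_ hn0.le (by positivity)
      calc n = n ^ (1 : ℝ) := (Real.rpow_one n).symm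
        _ ≤ _ := by
          refine Real.rpow_le_rpow_of_exponent_le (by linarith) ?_
          have : (0 : ℝ) ≤ 1 / (k : ℝ) := by positivity
          linarith
  obtain ⟨H₁, hH₁G, hc₁, hd₁⟩ := h₁ l hl1 V G hn
  obtain ⟨H₂, hH₂G, hc₂, hd₂⟩ := h₂ l hl1 V G hn
  have hCC₁ : C₁ ≤ (C₁ + C₂) * Real.exp 1 := by nlinarith
  have hCC₂ : 2 * C₂ ≤ (C₁ + C₂) * Real.exp 1 := by
    have : 2 ≤ Real.exp 1 := by linarith [Real.add_one_le_exp (1 : ℝ)]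
    nlinarith
  refine ⟨H₁ ⊔ H₂, sup_le hH₁G hH₂G, ?_, fun x y d hd => ?_⟩
  · calc ((H₁ ⊔ H₂).edgeSet.ncard : ℝ) ≤ H₁.edgeSet.ncard + H₂.edgeSet.ncard := by
          exact_mod_cast SimpleGraph.ncard_edgeSet_sup_le _ _
      _ ≤ C₁ * l ^ 3 * (n ^ (1 + 1 / (l : ℝ)) * T) + C₂ * l ^ 3 * (n ^ (1 + 1 / (l : ℝ)) * T) :=
          add_le_add hc₁ hc₂
      _ = (C₁ + C₂) * l ^ 3 * (n ^ (1 + 1 / (l : ℝ)) * T) := by ring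
      _ ≤ (C₁ + C₂) * T ^ 3 * (Real.exp 1 * n ^ (1 + 1 / (k : ℝ)) * T) := by gcongr
      _ = _ := by ring
  · obtain ⟨e₂, he₂, hb₂⟩ := hd₂ x y d hd
    have hsup₂ : (H₁ ⊔ H₂).edist x y ≤ e₂ :=
      (SimpleGraph.edist_anti le_sup_right).trans he₂
    have hm0 : (0 : ℝ) < m := by exact_mod_cast hm
    set a : ℝ := 1 / (m : ℝ) with ha
    have ha0 : 0 < a := by positivity
    have ha1 : a ≤ 1 := by
      rw [ha, div_le_one hm0]
      exact_mod_cast hm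
    have ha2 : 1 / ((2 * m : ℕ) : ℝ) = a / 2 := by
      rw [ha]
      push_cast
      field_simp
    rw [ha2] at hb₂ hd₁
    have hlong : (l : ℝ) ^ (1 + a / 2) ≤ k + d → (e₂ : ℝ) ≤ (C₁ + C₂) * Real.exp 1 * (k + d) := by
      intro h
      calc (e₂ : ℝ) ≤ C₂ * (d + (l : ℝ) ^ (1 + a / 2)) := hb₂
        _ ≤ C₂ * (2 * (k + d)) := by
          gcongr
          linarith
        _ = 2 * C₂ * (k + d) := by ring
        _ ≤ _ := by gcongr
    by_cases hshort : (d : ℝ) ≤ (l : ℝ) ^ (1 - a / 2)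
    · obtain ⟨e₁, he₁, hb₁⟩ := hd₁ x y d hd hshort
      refine ⟨e₁, (SimpleGraph.edist_anti le_sup_left).trans he₁, fun _ => hb₁.trans ?_⟩
      gcongr
      have : (0 : ℝ) ≤ d := Nat.cast_nonneg _
      linarith
    · refine ⟨e₂, hsup₂, fun hrange => hlong ?_⟩
      push Not at hshort
      rcases hrange with h | h
      -- The halved exponent leaves room to pass from `k` to `l`: otherwise d ≤ k^(1-a) ≤
      -- l^((1+a/2)(1-a)) ≤ l^(1-a/2), the short range already treated.
      · have h1 : (l : ℝ) ^ (1 + a / 2) ≤ k := by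
          by_contra hcon
          push Not at hcon
          have h2 : (k : ℝ) ^ (1 - a) ≤ ((l : ℝ) ^ (1 + a / 2)) ^ (1 - a) :=
            Real.rpow_le_rpow (by linarith) hcon.le (by linarith)
          rw [← Real.rpow_mul hl0.le] at h2
          have h3 : (l : ℝ) ^ ((1 + a / 2) * (1 - a)) ≤ (l : ℝ) ^ (1 - a / 2) :=
            Real.rpow_le_rpow_of_exponent_le hl1' (by nlinarith)
          linarith
        have : (0 : ℝ) ≤ d := Nat.cast_nonneg _
        linarith
      · calc (l : ℝ) ^ (1 + a / 2) ≤ (k : ℝ) ^ (1 + a / 2) := by gcongr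
          _ ≤ (k : ℝ) ^ (1 + a) := Real.rpow_le_rpow_of_exponent_le hk1 (by linarith)
          _ ≤ d := h
          _ ≤ k + d := by linarith

/-- A single subgraph serving all values of `δ`. -/
theorem exists_universal_spanner :
    ∃ (A : ℝ) (C : ℝ → ℝ), 0 ≤ A ∧ (∀ δ, 0 ≤ C δ) ∧
      ∀ (k : ℕ), 1 ≤ k → ∀ (V : Type u) [Fintype V] (G : SimpleGraph V),
      2 ≤ Fintype.card V → ∃ H ≤ G,
        (H.edgeSet.ncard : ℝ) ≤ A * (Fintype.card V : ℝ) ^ (1 + 1 / (k : ℝ)) *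
          Real.log (Fintype.card V) ^ 6 ∧
        ∀ x y, G.Reachable x y → H.Reachable x y ∧ ∀ δ : ℝ, 0 < δ → 1 ≤ G.dist x y →
          ((G.dist x y : ℝ) ≤ (k : ℝ) ^ (1 - δ) ∨ (k : ℝ) ^ (1 + δ) ≤ (G.dist x y : ℝ)) →
          (H.dist x y : ℝ) ≤ C δ * (k + G.dist x y) := by
  choose C hC0 hC using fun m : ℕ => exists_spanner_of_exponent.{u} (m + 1) (by omega)
  refine ⟨1215 * (C 0 + 1), fun δ => C ⌈1 / δ⌉₊ + Real.exp (⌈1 / δ⌉₊ + C ⌈1 / δ⌉₊), ?_, ?_, ?_⟩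
  · have := hC0 0
    positivity
  · intro δ
    have := hC0 ⌈1 / δ⌉₊
    positivity
  intro k hk V _ G hn
  choose H hHG hcard hdist using fun m => hC m k hk V G hn
  set n : ℝ := (Fintype.card V : ℝ) with hndef
  have hn2 : (2 : ℝ) ≤ n := by
    rw [hndef]
    exact_mod_cast hn
  have hn0 : 0 < n := by linarith
  have hk1 : (1 : ℝ) ≤ k := by exact_mod_cast hk
  have hlog : 1 / 2 ≤ Real.log n := by
    have h1 := Real.one_sub_inv_le_log_of_pos hn0
    have h2 : n⁻¹ ≤ 2⁻¹ := inv_anti₀ (by norm_num) hn2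
    linarith
  set T : ℝ := Real.log n + 1 with hT
  have hT0 : 0 < T := by linarith
  have hT1 : 1 ≤ T := by linarith
  -- The number of indices and the size of `C m` each cost one logarithm, raising the power from 4
  -- to 6. Index 0 is always kept, to ensure reachability.
  let I := (Finset.range ⌈T⌉₊).filter fun m => m = 0 ∨ C m ≤ T
  have hI0 : 0 ∈ I := Finset.mem_filter.2
    ⟨Finset.mem_range.2 (Nat.ceil_pos.2 hT0), Or.inl rfl⟩
  refine ⟨I.sup H, Finset.sup_le fun m _ => hHG m, ?_, fun x y hxy => ?_⟩
  · have hCI : ∀ m ∈ I, C m ≤ (C 0 + 1) * T := by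
      intro m hm
      have h0 := hC0 0
      rcases (Finset.mem_filter.1 hm).2 with rfl | h
      · nlinarith
      · nlinarith
    have hIc : (I.card : ℝ) ≤ T + 1 := by
      have h1 : (I.card : ℝ) ≤ (⌈T⌉₊ : ℝ) := by
        exact_mod_cast (Finset.card_filter_le _ _).trans (Finset.card_range _).le
      exact h1.trans (Nat.ceil_lt_add_one hT0.le).le
    have h0 := hC0 0
    calc ((I.sup H).edgeSet.ncard : ℝ) ≤ ∑ m ∈ I, ((H m).edgeSet.ncard : ℝ) := by
          exact_mod_cast SimpleGraph.ncard_edgeSet_finset_sup_le I H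
      _ ≤ ∑ m ∈ I, (C 0 + 1) * T * (n ^ (1 + 1 / (k : ℝ)) * T ^ 4) := by
          refine Finset.sum_le_sum fun m hm => (hcard m).trans ?_
          have := hCI m hm
          gcongr
      _ = I.card * ((C 0 + 1) * T * (n ^ (1 + 1 / (k : ℝ)) * T ^ 4)) := by
          rw [Finset.sum_const, nsmul_eq_mul]
      _ ≤ (T + 1) * ((C 0 + 1) * T * (n ^ (1 + 1 / (k : ℝ)) * T ^ 4)) := by gcongr
      _ = (C 0 + 1) * n ^ (1 + 1 / (k : ℝ)) * ((T + 1) * T ^ 5) := by ring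
      _ ≤ (C 0 + 1) * n ^ (1 + 1 / (k : ℝ)) * ((5 * Real.log n) * (3 * Real.log n) ^ 5) := by
          have h1 : T + 1 ≤ 5 * Real.log n := by linarith
          have h2 : T ≤ 3 * Real.log n := by linarith
          gcongr
      _ = 1215 * ((C 0 + 1) * n ^ (1 + 1 / (k : ℝ)) * Real.log n ^ 6) := by ring
      _ = _ := by ring
  · have hd : G.edist x y ≤ (G.dist x y : ℕ) := hxy.coe_dist_eq_edist.ge
    have hreach : (I.sup H).Reachable x y := by
      obtain ⟨e, he, -⟩ := hdist 0 x y _ hd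
      exact SimpleGraph.reachable_of_edist_ne_top (ne_top_of_le_ne_top (ENat.natCast_ne_top e)
        ((SimpleGraph.edist_anti (Finset.le_sup hI0)).trans he))
    refine ⟨hreach, fun δ hδ hd1 hrange => ?_⟩
    set m := ⌈1 / δ⌉₊ with hm
    have hCm := hC0 m
    have hd1' : (1 : ℝ) ≤ G.dist x y := by exact_mod_cast hd1
    have hmδ : 1 / ((m + 1 : ℕ) : ℝ) ≤ δ := by
      rw [div_le_comm₀ (by positivity) hδ]
      push_cast
      linarith [Nat.le_ceil (1 / δ)]
    by_cases hmI : m ∈ I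
    · obtain ⟨e, he, hb⟩ := hdist m x y _ hd
      have h1 : (I.sup H).dist x y ≤ e := by
        have := (SimpleGraph.edist_anti (Finset.le_sup hmI)).trans he
        rw [← hreach.coe_dist_eq_edist] at this
        exact_mod_cast this
      have h2 := hb (hrange.imp
        (fun h => h.trans (Real.rpow_le_rpow_of_exponent_le hk1 (by linarith)))
        (fun h => (Real.rpow_le_rpow_of_exponent_le hk1 (by linarith)).trans h))
      calc ((I.sup H).dist x y : ℝ) ≤ e := by exact_mod_cast h1
        _ ≤ C m * (k + G.dist x y) := h2
        _ ≤ _ := by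
          gcongr
          exact le_add_of_nonneg_right (Real.exp_pos _).le
    -- An omitted `m` bounds n by a function of `m`, hence of δ, and every distance in the spanner
    -- is at most n.
    · have hTm : T ≤ m + C m + 1 := by
        by_contra hcon
        push Not at hcon
        refine hmI (Finset.mem_filter.2 ⟨Finset.mem_range.2 (Nat.lt_ceil.2 (by linarith)),
          Or.inr ?_⟩)
        have : (0 : ℝ) ≤ m := Nat.cast_nonneg _
        linarith
      have h1 : n ≤ Real.exp (m + C m) := by
        rw [← Real.exp_log hn0]
        exact Real.exp_le_exp.2 (by linarith)
      have h2 : ((I.sup H).dist x y : ℝ) ≤ n := by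
        obtain ⟨p, hp, hpl⟩ := hreach.exists_path_of_dist
        rw [← hpl, hndef]
        exact_mod_cast hp.length_lt.le
      have hE := Real.exp_pos (m + C m)
      calc ((I.sup H).dist x y : ℝ) ≤ Real.exp (m + C m) := h2.trans h1
        _ ≤ (C m + Real.exp (m + C m)) * (k + G.dist x y) := by nlinarith

theorem theorem1 :
    ∃ (A : ℝ) (c : ℕ) (C : ℝ → ℝ),
      ∀ (k : ℕ), 1 ≤ k → ∀ (V : Type*) [Fintype V] (G : SimpleGraph V),
        ∃ (H : SimpleGraph V) (f : ℕ → ℝ),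
          G.IsSpanner H f ∧
          (H.edgeSet.ncard : ℝ) ≤
            A * (Fintype.card V : ℝ) ^ (1 + 1 / (k : ℝ)) * Real.log (Fintype.card V) ^ c ∧
          ∀ δ : ℝ, 0 < δ → ∀ d : ℕ, 1 ≤ d → d ≤ Fintype.card V →
            ((d : ℝ) ≤ (k : ℝ) ^ (1 - δ) ∨ (k : ℝ) ^ (1 + δ) ≤ (d : ℝ)) →
            f d / (d : ℝ) ≤ C δ * ((k : ℝ) / (d : ℝ) + 1) := by
  obtain ⟨A, C, hA, hC, h⟩ := exists_universal_spanner
  refine ⟨A, 6, C, fun k hk V _ G => ?_⟩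
  classical
  suffices hmain : ∃ H ≤ G, (H.edgeSet.ncard : ℝ) ≤ A * (Fintype.card V : ℝ) ^ (1 + 1 / (k : ℝ)) *
      Real.log (Fintype.card V) ^ 6 ∧
      ∀ x y, G.Reachable x y → H.Reachable x y ∧ ∀ δ : ℝ, 0 < δ → 1 ≤ G.dist x y →
        ((G.dist x y : ℝ) ≤ (k : ℝ) ^ (1 - δ) ∨ (k : ℝ) ^ (1 + δ) ≤ (G.dist x y : ℝ)) →
        (H.dist x y : ℝ) ≤ C δ * (k + G.dist x y) by
    obtain ⟨H, hHG, hcard, hH⟩ := hmain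
    -- The least possible `f`: the worst distance in `H` over pairs at distance exactly `d`, and 0
    -- if there are none.
    refine ⟨H, fun d => (((Finset.univ.filter fun p : V × V =>
      G.Reachable p.1 p.2 ∧ G.dist p.1 p.2 = d).sup fun p => H.dist p.1 p.2 : ℕ) : ℝ),
      ⟨hHG, fun u v huv => ⟨(hH u v huv).1, ?_⟩⟩, hcard, fun δ hδ d hd _ hrange => ?_⟩
    · have hmem : (u, v) ∈ Finset.univ.filter fun p : V × V =>
          G.Reachable p.1 p.2 ∧ G.dist p.1 p.2 = G.dist u v :=
        Finset.mem_filter.2 ⟨Finset.mem_univ _, huv, rfl⟩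
      exact Nat.cast_le.2 (Finset.le_sup (f := fun p : V × V => H.dist p.1 p.2) hmem)
    · have hd0 : (0 : ℝ) < d := by exact_mod_cast hd
      have hnn : 0 ≤ C δ * ((k : ℝ) + d) := mul_nonneg (hC δ) (by positivity)
      have hrw : C δ * ((k : ℝ) / d + 1) = C δ * (k + d) / d := by
        field_simp
      rw [hrw]
      refine div_le_div_of_nonneg_right ((Nat.le_floor_iff hnn).1 (Finset.sup_le ?_)) hd0.le
      rintro ⟨x, y⟩ hp
      obtain ⟨-, hr, rfl⟩ := Finset.mem_filter.1 hp
      exact Nat.le_floor ((hH x y hr).2 δ hδ hd hrange)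
  by_cases hn : 2 ≤ Fintype.card V
  · exact h k hk V G hn
  -- For n ≤ 1 the logarithm vanishes, so the edge bound is 0 and `H` must be edgeless.
  · have : Subsingleton V := Fintype.card_le_one_iff_subsingleton.1 (by omega)
    have hbot : G = ⊥ := Subsingleton.elim _ _
    refine ⟨G, le_rfl, ?_, fun x y hxy => ⟨hxy, fun δ _ hd _ => ?_⟩⟩
    · rw [hbot, SimpleGraph.edgeSet_bot, Set.ncard_empty, Nat.cast_zero]
      exact mul_nonneg (mul_nonneg hA (by positivity)) (pow_nonneg (Real.log_natCast_nonneg _) _)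
    · rw [Subsingleton.elim x y, SimpleGraph.dist_self] at hd
      omega
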